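/- All graphs are finite, simple and undirected. For integers $p-2\ge k\ge 1$ and $q\ge 1$, let $K_{p,k}^{q}$ (generalized pineapple graph) be the graph obtained from the complete graph $K_p$ and an independent set of $q$ further vertices by joining each of these $q$ vertices to the same $k$ vertices of $K_p$. For integers $m,n\ge 1$, let $CS_{m,n}$ be the complete split graph obtained from a complete graph $K_m$ and an independent set of $n$ vertices by adding all edges between them. Two graphs are cospectral if their adjacency matrices have the same eigenvalues with the same multiplicities. **Theorem 3.1.** Let $p-2\ge k\ge 1$, $q\ge 1$ and $a\ge 0$ be integers, and let $G=G_1\cup G_2\cup aK_1$ be the disjoint union of two connected graphs $G_1,G_2$, each with at least one edge, and $a$ isolated vertices. Then $G$ is cospectral with $K_{p,k}^{q}$ if and only if all of the following hold: (i) $a$ is a root of the equation $$\begin{aligned}&kx^3+[p-p^2+kp+(1-2q)k]x^2+[(2q-1)p^2-4pqk+pk+(1-2q)p+2qk^2+q^2k]x\\&\quad+(k+1-q)p^2q+[(3q-3)k-2k^2+q-1]pq+qk^3+2(1-q)qk^2+(1-q)qk=0;\end{aligned}$$ (ii) $a<q-1$; (iii) $p+q-k-1-a$ divides $(q-a)(p-k)$;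 (iv) $G$ is isomorphic to $K_t\cup CS_{m,n}\cup aK_1$, where $$n=q-a,\qquad t=\frac{(q-a)(p-k)}{p+q-a-k-1},\qquad m=\frac{p^2-(k+1)p+kq-ka}{p+q-a-k-1}$$ are positive integers. -/

import Mathlib

open scoped SimpleGraph

/-- The adjacency spectrum of a finite graph: the multiset of eigenvalues of its real adjacency
matrix, that is, the real roots of the characteristic polynomial with multiplicity (the matrix is
real symmetric, so all the roots of its characteristic polynomial are real). -/
noncomputable def adjSpectrum {V : Type*} [Fintype V] (G : SimpleGraph V) : Multiset ℝ :=
  open Classical in (G.adjMatrix ℝ).charpoly.roots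

/-- Two finite graphs are cospectral if they have the same adjacency spectrum. -/
def Cospectral {V W : Type*} [Fintype V] [Fintype W]
    (G : SimpleGraph V) (H : SimpleGraph W) : Prop :=
  adjSpectrum G = adjSpectrum H

/-- The generalized pineapple graph `K_{p,k}^q`: a complete graph on `p` vertices and an independent
set of `q` vertices, each vertex of the latter being joined exactly to the first `k` vertices of
the complete graph. It is used for `k ≤ p` only. -/
def genPineapple (p k q : ℕ) : SimpleGraph (Fin p ⊕ Fin q) where
  Adj
    | .inl i, .inl j => i ≠ j
    | .inl i, .inr _ => i.val < k
    | .inr _, .inl j => j.val < k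
    | .inr _, .inr _ => False
  symm := ⟨by
    rintro (i | i) (j | j) h
    · exact fun e => h e.symm
    · exact h
    · exact h
    · exact h⟩
  loopless := ⟨by
    rintro (i | i) h
    · exact h rfl
    · exact h⟩

/-- The complete split graph with a clique of `m` vertices and an independent set of `n` vertices,
all the edges between the two being present. -/
def completeSplit (m n : ℕ) : SimpleGraph (Fin m ⊕ Fin n) where
  Adj
    | .inl i, .inl j => i ≠ j
    | .inl _, .inr _ => True
    | .inr _, .inl _ => True
    | .inr _, .inr _ => False
  symm := ⟨by
    rintro (i | i) (j | j) h
    · exact fun e => h e.symm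
    · exact h
    · exact h
    · exact h⟩
  loopless := ⟨by
    rintro (i | i) h
    · exact h rfl
    · exact h⟩

open Polynomial Matrix

/-! The nontrivial eigenvalues of `K_{p,k}^q` are the roots of one cubic: apart from -1 and 0, the
spectrum consists of three roots, of which at most two are positive and at most one is below -1.

Suppose G is cospectral with it. Each of G₁, G₂ has an edge, hence a positive eigenvalue, so each
has exactly one; and one of the two has no eigenvalue below -1. The latter contains no induced path
on three vertices, so it is complete. In the other, a single positive eigenvalue makes non-adjacency
transitive (complete multipartite), and having at most one eigenvalue below -1 excludes `K_{2,2,1}`;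
what remains is complete split or complete bipartite
(`exists_iso_completeSplit_or_completeBipartiteGraph`).

Comparing characteristic polynomials rules out the bipartite case and, in the split case, leaves
four integer equations (`cospectral_completeSplit_iff`). Solving them for n, t, m turns the
remaining equation qk = m(n - t) into the cubic in a (`root_equation_eq`). -/

/-- The characteristic polynomial of the real adjacency matrix of a finite graph. -/
noncomputable def adjCharpoly {V : Type*} [Fintype V] (G : SimpleGraph V) : ℝ[X] :=
  open Classical in (G.adjMatrix ℝ).charpoly

/-! ### Spectra and characteristic polynomials -/

section Basic

variable {V W : Type*} [Fintype V] [Fintype W]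

theorem adjCharpoly_eq [DecidableEq V] (G : SimpleGraph V) [DecidableRel G.Adj] :
    adjCharpoly G = (G.adjMatrix ℝ).charpoly := by
  unfold adjCharpoly
  congr!

theorem adjSpectrum_eq_roots (G : SimpleGraph V) : adjSpectrum G = (adjCharpoly G).roots := rfl

theorem adjCharpoly_monic (G : SimpleGraph V) : (adjCharpoly G).Monic := by
  classical
  exact Matrix.charpoly_monic _

theorem adjCharpoly_splits (G : SimpleGraph V) : (adjCharpoly G).Splits := by
  classical
  exact (G.isHermitian_adjMatrix ℝ).splits_charpoly

theorem natDegree_adjCharpoly (G : SimpleGraph V) :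
    (adjCharpoly G).natDegree = Fintype.card V := by
  classical
  exact Matrix.charpoly_natDegree_eq_dim _

/-- The polynomials are monic and split over ℝ, so their roots determine them. -/
theorem cospectral_iff_adjCharpoly_eq (G : SimpleGraph V) (H : SimpleGraph W) :
    Cospectral G H ↔ adjCharpoly G = adjCharpoly H := by
  rw [Cospectral, adjSpectrum_eq_roots, adjSpectrum_eq_roots]
  refine ⟨fun h => ?_, fun h => by rw [h]⟩
  rw [(adjCharpoly_splits G).eq_prod_roots_of_monic (adjCharpoly_monic G),
    (adjCharpoly_splits H).eq_prod_roots_of_monic (adjCharpoly_monic H), h]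

theorem SimpleGraph.Iso.adjCharpoly_eq {G : SimpleGraph V} {H : SimpleGraph W} (e : G ≃g H) :
    adjCharpoly G = adjCharpoly H := by
  classical
  rw [_root_.adjCharpoly_eq, _root_.adjCharpoly_eq, ← e.reindex_adjMatrix ℝ,
    Matrix.charpoly_reindex]

theorem adjCharpoly_sum (G : SimpleGraph V) (H : SimpleGraph W) :
    adjCharpoly (G ⊕g H) = adjCharpoly G * adjCharpoly H := by
  classical
  rw [adjCharpoly_eq, adjCharpoly_eq, adjCharpoly_eq, ← Matrix.charpoly_fromBlocks_zero₁₂ (M₂₁ := 0)]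
  congr 1
  ext (i | i) (j | j) <;> simp [SimpleGraph.adjMatrix_apply]

theorem adjSpectrum_sum (G : SimpleGraph V) (H : SimpleGraph W) :
    adjSpectrum (G ⊕g H) = adjSpectrum G + adjSpectrum H := by
  simp only [adjSpectrum_eq_roots, adjCharpoly_sum]
  exact roots_mul ((adjCharpoly_monic G).mul (adjCharpoly_monic H)).ne_zero

theorem adjCharpoly_bot : adjCharpoly (⊥ : SimpleGraph V) = X ^ Fintype.card V := by
  classical
  rw [adjCharpoly_eq, SimpleGraph.adjMatrix_bot, Matrix.charpoly_zero]

end Basic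

/-! ### Quadratic forms in an eigenbasis -/

section Signature

variable {V : Type*} [Fintype V] [DecidableEq V] {A : Matrix V V ℝ}

theorem Matrix.IsHermitian.dotProduct_mulVec_eq_sum (hA : A.IsHermitian) (v : V → ℝ) :
    v ⬝ᵥ A *ᵥ v =
      ∑ i, hA.eigenvalues i * ((hA.eigenvectorUnitary : Matrix V V ℝ)ᵀ *ᵥ v) i ^ 2 := by
  set U : Matrix V V ℝ := hA.eigenvectorUnitary.1 with hU
  have h : A = U * diagonal hA.eigenvalues * Uᵀ := by
    conv_lhs => rw [hA.spectral_theorem, Unitary.conjStarAlgAut_apply]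
    rfl
  conv_lhs => rw [h]
  rw [← mulVec_mulVec, ← mulVec_mulVec, dotProduct_mulVec, ← mulVec_transpose]
  simp only [dotProduct, mulVec_diagonal]
  exact Finset.sum_congr rfl fun i _ => by ring

theorem Matrix.IsHermitian.dotProduct_self_eq_sum (hA : A.IsHermitian) (v : V → ℝ) :
    v ⬝ᵥ v = ∑ i, ((hA.eigenvectorUnitary : Matrix V V ℝ)ᵀ *ᵥ v) i ^ 2 := by
  set U : Matrix V V ℝ := hA.eigenvectorUnitary.1 with hU
  have h : U * Uᵀ = 1 := Unitary.coe_mul_star_self hA.eigenvectorUnitary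
  conv_lhs => enter [2]; rw [← one_mulVec v, ← h, ← mulVec_mulVec]
  rw [dotProduct_mulVec, ← mulVec_transpose]
  simp only [dotProduct, sq]

-- Dimension count: d unknown coefficients against fewer than d linear conditions.
omit [DecidableEq V] in
theorem exists_ne_zero_mulVec_sum_eq_zero (B : Matrix V V ℝ) (P : V → Prop) [DecidablePred P]
    {d : ℕ} (hd : (Finset.univ.filter P).card < d) (w : Fin d → V → ℝ) :
    ∃ c : Fin d → ℝ, c ≠ 0 ∧ ∀ i, P i → (B *ᵥ ∑ j, c j • w j) i = 0 := by
  let f : (Fin d → ℝ) →ₗ[ℝ] ({i // P i} → ℝ) :=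
    (LinearMap.funLeft ℝ ℝ Subtype.val) ∘ₗ B.mulVecLin ∘ₗ Fintype.linearCombination ℝ w
  have hf : LinearMap.ker f ≠ ⊥ := by
    apply LinearMap.ker_ne_bot_of_finrank_lt
    simpa [Fintype.card_subtype] using hd
  obtain ⟨c, hc, hc0⟩ := (Submodule.ne_bot_iff _).1 hf
  refine ⟨c, hc0, fun i hi => ?_⟩
  have := congrFun (LinearMap.mem_ker.1 hc) ⟨i, hi⟩
  simpa only [f, LinearMap.comp_apply, LinearMap.funLeft_apply, mulVecLin_apply,
    Fintype.linearCombination_apply, Pi.zero_apply] using this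

end Signature

/-! ### Counting eigenvalues with test vectors -/

section GraphSignature

variable {V : Type*} [Fintype V]

theorem adjSpectrum_eq_map [DecidableEq V] (G : SimpleGraph V) [DecidableRel G.Adj] :
    adjSpectrum G = Finset.univ.val.map (G.isHermitian_adjMatrix ℝ).eigenvalues := by
  rw [adjSpectrum_eq_roots, adjCharpoly_eq, (G.isHermitian_adjMatrix ℝ).roots_charpoly_eq_eigenvalues]
  rfl

/-- With fewer than d positive eigenvalues, some nonzero combination of the `w j` would be
orthogonal to all their eigenvectors, and the form of A would be nonpositive on it. -/
theorem le_countP_pos_adjSpectrum (G : SimpleGraph V) [DecidableRel G.Adj] {d : ℕ}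
    (w : Fin d → V → ℝ)
    (hw : ∀ c : Fin d → ℝ, c ≠ 0 →
      0 < (∑ j, c j • w j) ⬝ᵥ G.adjMatrix ℝ *ᵥ (∑ j, c j • w j)) :
    d ≤ (adjSpectrum G).countP (0 < ·) := by
  classical
  by_contra! h
  set hA := (G.isHermitian_adjMatrix ℝ)
  rw [adjSpectrum_eq_map, Multiset.countP_map] at h
  obtain ⟨c, hc, h0⟩ := exists_ne_zero_mulVec_sum_eq_zero
    (hA.eigenvectorUnitary : Matrix V V ℝ)ᵀ (fun i => 0 < hA.eigenvalues i) h w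
  refine (hw c hc).not_ge ?_
  rw [hA.dotProduct_mulVec_eq_sum]
  refine Finset.sum_nonpos fun i _ => ?_
  by_cases hi : 0 < hA.eigenvalues i
  · simp [h0 i hi]
  · exact mul_nonpos_of_nonpos_of_nonneg (not_lt.1 hi) (sq_nonneg _)

/-- The same argument for negative values of the form of A + I. -/
theorem le_countP_lt_neg_one_adjSpectrum (G : SimpleGraph V) [DecidableRel G.Adj] {d : ℕ}
    (w : Fin d → V → ℝ)
    (hw : ∀ c : Fin d → ℝ, c ≠ 0 →
      (∑ j, c j • w j) ⬝ᵥ G.adjMatrix ℝ *ᵥ (∑ j, c j • w j)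
        + (∑ j, c j • w j) ⬝ᵥ (∑ j, c j • w j) < 0) :
    d ≤ (adjSpectrum G).countP (· < -1) := by
  classical
  by_contra! h
  set hA := (G.isHermitian_adjMatrix ℝ)
  rw [adjSpectrum_eq_map, Multiset.countP_map] at h
  obtain ⟨c, hc, h0⟩ := exists_ne_zero_mulVec_sum_eq_zero
    (hA.eigenvectorUnitary : Matrix V V ℝ)ᵀ (fun i => hA.eigenvalues i < -1) h w
  refine (hw c hc).not_ge ?_
  rw [hA.dotProduct_mulVec_eq_sum, hA.dotProduct_self_eq_sum, ← Finset.sum_add_distrib]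
  refine Finset.sum_nonneg fun i _ => ?_
  by_cases hi : hA.eigenvalues i < -1
  · simp [h0 i hi]
  · nlinarith [sq_nonneg (((hA.eigenvectorUnitary : Matrix V V ℝ)ᵀ *ᵥ ∑ j, c j • w j) i)]

theorem binary_quadratic_pos {α β γ : ℝ} (hα : 0 < α) (h : β ^ 2 < α * γ) {c : Fin 2 → ℝ}
    (hc : c ≠ 0) : 0 < α * c 0 ^ 2 + 2 * β * (c 0 * c 1) + γ * c 1 ^ 2 := by
  have e : α * (α * c 0 ^ 2 + 2 * β * (c 0 * c 1) + γ * c 1 ^ 2)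
      = (α * c 0 + β * c 1) ^ 2 + (α * γ - β ^ 2) * c 1 ^ 2 := by ring
  refine pos_of_mul_pos_right (a := α) ?_ hα.le
  rw [e]
  by_cases h1 : c 1 = 0
  · have h0 : c 0 ≠ 0 := fun h0 => hc (funext fun i => by fin_cases i <;> simp [h0, h1])
    rw [h1]
    have := mul_pos (pow_pos hα 2) (pow_pos (abs_pos.2 h0) 2)
    rw [sq_abs] at this
    linarith
  · have : 0 < α * γ - β ^ 2 := sub_pos.2 h
    positivity

theorem adjMatrix_dotProduct_mulVec_comm (G : SimpleGraph V) [DecidableRel G.Adj] (x y : V → ℝ) :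
    y ⬝ᵥ G.adjMatrix ℝ *ᵥ x = x ⬝ᵥ G.adjMatrix ℝ *ᵥ y := by
  rw [dotProduct_mulVec, ← mulVec_transpose, G.transpose_adjMatrix, dotProduct_comm]

theorem two_le_countP_pos_adjSpectrum (G : SimpleGraph V) [DecidableRel G.Adj] (x y : V → ℝ)
    (hx : 0 < x ⬝ᵥ G.adjMatrix ℝ *ᵥ x)
    (hxy : (x ⬝ᵥ G.adjMatrix ℝ *ᵥ y) ^ 2
      < (x ⬝ᵥ G.adjMatrix ℝ *ᵥ x) * (y ⬝ᵥ G.adjMatrix ℝ *ᵥ y)) :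
    2 ≤ (adjSpectrum G).countP (0 < ·) := by
  refine le_countP_pos_adjSpectrum G ![x, y] fun c hc => ?_
  simp only [Fin.sum_univ_two, cons_val_zero, cons_val_one, mulVec_add, mulVec_smul,
    add_dotProduct, dotProduct_add, smul_dotProduct, dotProduct_smul, smul_eq_mul,
    adjMatrix_dotProduct_mulVec_comm G x y]
  linarith [binary_quadratic_pos hx hxy hc]

theorem two_le_countP_lt_neg_one_adjSpectrum (G : SimpleGraph V) [DecidableRel G.Adj]
    (x y : V → ℝ)
    (hx : x ⬝ᵥ G.adjMatrix ℝ *ᵥ x + x ⬝ᵥ x < 0)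
    (hxy : (x ⬝ᵥ G.adjMatrix ℝ *ᵥ y + x ⬝ᵥ y) ^ 2
      < (x ⬝ᵥ G.adjMatrix ℝ *ᵥ x + x ⬝ᵥ x) * (y ⬝ᵥ G.adjMatrix ℝ *ᵥ y + y ⬝ᵥ y)) :
    2 ≤ (adjSpectrum G).countP (· < -1) := by
  refine le_countP_lt_neg_one_adjSpectrum G ![x, y] fun c hc => ?_
  simp only [Fin.sum_univ_two, cons_val_zero, cons_val_one, mulVec_add, mulVec_smul,
    add_dotProduct, dotProduct_add, smul_dotProduct, dotProduct_smul, smul_eq_mul,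
    adjMatrix_dotProduct_mulVec_comm G x y, dotProduct_comm y x]
  rw [← neg_sq, ← neg_mul_neg] at hxy
  linarith [binary_quadratic_pos (neg_pos.2 hx) hxy hc]

theorem one_le_countP_pos_adjSpectrum (G : SimpleGraph V) [DecidableRel G.Adj] (x : V → ℝ)
    (hx : 0 < x ⬝ᵥ G.adjMatrix ℝ *ᵥ x) : 1 ≤ (adjSpectrum G).countP (0 < ·) := by
  refine le_countP_pos_adjSpectrum G ![x] fun c hc => ?_
  have h0 : c 0 ≠ 0 := fun h0 => hc (funext fun i => by fin_cases i; simp [h0])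
  simp only [Fin.sum_univ_one, cons_val_fin_one, mulVec_smul, smul_dotProduct, dotProduct_smul,
    smul_eq_mul]
  rw [← mul_assoc]
  exact mul_pos (mul_self_pos.2 h0) hx

theorem one_le_countP_lt_neg_one_adjSpectrum (G : SimpleGraph V) [DecidableRel G.Adj]
    (x : V → ℝ) (hx : x ⬝ᵥ G.adjMatrix ℝ *ᵥ x + x ⬝ᵥ x < 0) :
    1 ≤ (adjSpectrum G).countP (· < -1) := by
  refine le_countP_lt_neg_one_adjSpectrum G ![x] fun c hc => ?_
  have h0 : c 0 ≠ 0 := fun h0 => hc (funext fun i => by fin_cases i; simp [h0])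
  simp only [Fin.sum_univ_one, cons_val_fin_one, mulVec_smul, smul_dotProduct, dotProduct_smul,
    smul_eq_mul]
  nlinarith [mul_pos_of_neg_of_neg hx (neg_lt_zero.2 (pow_pos (abs_pos.2 h0) 2)), sq_abs (c 0)]

end GraphSignature

/-! ### Determinants of matrices constant on classes -/

section Quotient

variable {V R : Type*} [Fintype V] [DecidableEq V] [Fintype R] [DecidableEq R]

/-- The determinant `det (x - A)` of a matrix whose entries depend only on the classes of a
partition, apart from a correction on the diagonal. -/
theorem det_smul_one_sub_of_partition (π : V → R) (Q : Matrix R R ℝ) (d : R → ℝ) (x : ℝ)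
    (hx : ∀ s, x + d s ≠ 0) (A : Matrix V V ℝ)
    (hA : ∀ i j, A i j = Q (π i) (π j) - if i = j then d (π i) else 0)
    (N : R → ℕ) (hN : ∀ s, (Finset.univ.filter fun i => π i = s).card = N s) :
    (scalar V x - A).det = (∏ s, (x + d s) ^ N s) *
      (of fun s r => (1 : Matrix R R ℝ) s r - Q s r * (N r * (x + d r)⁻¹)).det := by
  simp only [← hN]
  let P : Matrix V R ℝ := of fun i s => if π i = s then 1 else 0
  let E : Matrix V V ℝ := diagonal fun i => x + d (π i)
  let F : Matrix V V ℝ := diagonal fun i => (x + d (π i))⁻¹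
  have hEF : E * F = 1 := by
    simp only [E, F, diagonal_mul_diagonal, mul_inv_cancel₀ (hx _), diagonal_one]
  have hPQP : ∀ i j, (P * Q * Pᵀ) i j = Q (π i) (π j) := fun i j => by
    simp [P, Matrix.mul_apply]
  -- A is P Q Pᵀ minus a diagonal matrix, with P the incidence matrix of vertices and classes.
  -- Taking out E leaves 1 - MN, and det(1 - MN) = det(1 - NM) passes to a matrix indexed by the
  -- classes.
  have h1 : scalar V x - A = E * (1 - F * P * (Q * Pᵀ)) := by
    rw [mul_sub, mul_one, ← Matrix.mul_assoc, ← Matrix.mul_assoc, ← Matrix.mul_assoc, hEF,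
      Matrix.one_mul]
    ext i j
    rw [Matrix.sub_apply, Matrix.sub_apply, hPQP, hA]
    by_cases h : i = j
    · subst h; simp [E]; ring
    · simp [E, h]
  have h2 : Q * Pᵀ * (F * P) = Q * diagonal fun s =>
        ((Finset.univ.filter fun i => π i = s).card : ℝ) * (x + d s)⁻¹ := by
    rw [Matrix.mul_assoc]
    congr 1
    ext s r
    simp only [P, F, Matrix.mul_apply (M := (of _)ᵀ), diagonal_mul, transpose_apply, of_apply,
      diagonal_apply]
    by_cases h : s = r
    · subst h
      simp only [if_true, Finset.card_eq_sum_ones, Nat.cast_sum, Finset.sum_mul,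
        Finset.sum_filter]
      refine Finset.sum_congr rfl fun i _ => ?_
      split_ifs with h <;> simp [h]
    · rw [if_neg h]
      refine Finset.sum_eq_zero fun i _ => ?_
      split_ifs with h1 h2
      · exact absurd (h1.symm.trans h2) h
      all_goals simp
  rw [h1, det_mul, det_one_sub_mul_comm, h2, det_diagonal,
    ← Finset.prod_fiberwise' _ π fun s => x + d s]
  simp only [Finset.prod_const]
  congr 2
  ext s r
  rw [Matrix.sub_apply, mul_diagonal, of_apply]

end Quotient

/-! ### Characteristic polynomials of the graphs involved -/

theorem Polynomial.eq_of_eval_eq_of_pos {f g : ℝ[X]} (h : ∀ x : ℝ, 0 < x → f.eval x = g.eval x) :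
    f = g :=
  eq_of_infinite_eval_eq f g ((Set.Ioi_infinite (0 : ℝ)).mono fun x hx => h x hx)

theorem adjCharpoly_top (t : ℕ) (ht : 1 ≤ t) :
    adjCharpoly (⊤ : SimpleGraph (Fin t)) = (X + 1) ^ (t - 1) * (X - C ((t : ℝ) - 1)) := by
  obtain ⟨t, rfl⟩ := Nat.exists_eq_add_of_le' ht
  -- Positive x keeps x + d invertible; d is 1 on clique classes, where it removes the loops, and 0
  -- on independent ones.
  refine eq_of_eval_eq_of_pos fun x hx => ?_
  rw [adjCharpoly_eq, eval_charpoly, det_smul_one_sub_of_partition (fun _ => (0 : Fin 1))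
    (of fun _ _ => 1) (fun _ => 1) x ?hx _ ?hA (fun _ => t + 1) ?hN]
  · have : x + 1 ≠ 0 := by positivity
    simp
    field_simp
    ring
  case hA =>
    intro i j
    by_cases h : i = j <;> simp [h, SimpleGraph.adjMatrix_apply]
  case hN =>
    intro s
    simp [Subsingleton.elim 0 s]
  case hx => exact fun _ => by positivity

theorem card_filter_sum {α β : Type*} [Fintype α] [Fintype β] (P : α ⊕ β → Prop)
    [DecidablePred P] : (Finset.univ.filter P).card =
      (Finset.univ.filter fun a => P (.inl a)).card +
        (Finset.univ.filter fun b => P (.inr b)).card := by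
  simp only [Finset.card_filter, Fintype.sum_sum_type]

section Adj

variable {m n p k q : ℕ}

@[simp] theorem completeSplit_adj_inl_inl {i j : Fin m} :
    (completeSplit m n).Adj (.inl i) (.inl j) ↔ i ≠ j := Iff.rfl

@[simp] theorem completeSplit_adj_inl_inr {i : Fin m} {j : Fin n} :
    (completeSplit m n).Adj (.inl i) (.inr j) := trivial

@[simp] theorem completeSplit_adj_inr_inl {i : Fin n} {j : Fin m} :
    (completeSplit m n).Adj (.inr i) (.inl j) := trivial

@[simp] theorem not_completeSplit_adj_inr_inr {i j : Fin n} :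
    ¬ (completeSplit m n).Adj (.inr i) (.inr j) := id

@[simp] theorem genPineapple_adj_inl_inl {i j : Fin p} :
    (genPineapple p k q).Adj (.inl i) (.inl j) ↔ i ≠ j := Iff.rfl

@[simp] theorem genPineapple_adj_inl_inr {i : Fin p} {j : Fin q} :
    (genPineapple p k q).Adj (.inl i) (.inr j) ↔ i.val < k := Iff.rfl

@[simp] theorem genPineapple_adj_inr_inl {i : Fin q} {j : Fin p} :
    (genPineapple p k q).Adj (.inr i) (.inl j) ↔ j.val < k := Iff.rfl

@[simp] theorem not_genPineapple_adj_inr_inr {i j : Fin q} :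
    ¬ (genPineapple p k q).Adj (.inr i) (.inr j) := id

end Adj

theorem adjCharpoly_completeSplit (m n : ℕ) (hm : 1 ≤ m) (hn : 1 ≤ n) :
    adjCharpoly (completeSplit m n) = (X + 1) ^ (m - 1) * X ^ (n - 1) *
      (X ^ 2 - C ((m : ℝ) - 1) * X - C ((m : ℝ) * n)) := by
  classical
  obtain ⟨m, rfl⟩ := Nat.exists_eq_add_of_le' hm
  obtain ⟨n, rfl⟩ := Nat.exists_eq_add_of_le' hn
  refine eq_of_eval_eq_of_pos fun x hx => ?_
  rw [adjCharpoly_eq, eval_charpoly, det_smul_one_sub_of_partition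
    (Sum.elim (fun _ => (0 : Fin 2)) (fun _ => 1)) !![1, 1; 1, 0] ![1, 0] x ?hx _ ?hA
      ![m + 1, n + 1] ?hN]
  · have : x + 1 ≠ 0 := by positivity
    simp [det_fin_two, Fin.prod_univ_two]
    field_simp
    ring
  case hx =>
    intro s; fin_cases s <;> simp <;> positivity
  case hA =>
    rintro (i | i) (j | j)
    · by_cases h : i = j <;> simp [h, SimpleGraph.adjMatrix_apply]
    all_goals simp [SimpleGraph.adjMatrix_apply]
  case hN =>
    intro s
    fin_cases s <;> simp [card_filter_sum]

theorem adjCharpoly_completeBipartiteGraph (m n : ℕ) (hm : 1 ≤ m) (hn : 1 ≤ n) :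
    adjCharpoly (completeBipartiteGraph (Fin m) (Fin n)) = X ^ (m + n - 2) *
      (X ^ 2 - C ((m : ℝ) * n)) := by
  classical
  obtain ⟨m, rfl⟩ := Nat.exists_eq_add_of_le' hm
  obtain ⟨n, rfl⟩ := Nat.exists_eq_add_of_le' hn
  refine eq_of_eval_eq_of_pos fun x hx => ?_
  rw [adjCharpoly_eq, eval_charpoly, det_smul_one_sub_of_partition
    (Sum.elim (fun _ => (0 : Fin 2)) (fun _ => 1)) !![0, 1; 1, 0] ![0, 0] x ?hx _ ?hA
      ![m + 1, n + 1] ?hN]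
  · rw [show m + 1 + (n + 1) - 2 = m + n by omega]
    simp [det_fin_two, Fin.prod_univ_two]
    field_simp
    ring
  case hx =>
    intro s; fin_cases s <;> simp <;> positivity
  case hA =>
    rintro (i | i) (j | j) <;> simp [SimpleGraph.adjMatrix_apply]
  case hN =>
    intro s
    fin_cases s <;> simp [card_filter_sum]

/-- The cubic factor of the characteristic polynomial of `K_{p,k}^q`. -/
noncomputable def pineappleCubic (p k q : ℕ) : ℝ[X] :=
  (X - C ((p : ℝ) - k - 1)) * (X ^ 2 - C ((k : ℝ) - 1) * X - C ((q : ℝ) * k))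
    - C ((k : ℝ) * (p - k)) * X

theorem adjCharpoly_genPineapple (p k q : ℕ) (hk : 1 ≤ k) (hkp : k + 2 ≤ p) (hq : 1 ≤ q) :
    adjCharpoly (genPineapple p k q) =
      (X + 1) ^ (p - 2) * X ^ (q - 1) * pineappleCubic p k q := by
  classical
  obtain ⟨r, rfl⟩ := Nat.exists_eq_add_of_le hkp
  obtain ⟨k, rfl⟩ := Nat.exists_eq_add_of_le' hk
  obtain ⟨q, rfl⟩ := Nat.exists_eq_add_of_le' hq
  refine eq_of_eval_eq_of_pos fun x hx => ?_
  rw [adjCharpoly_eq, eval_charpoly, det_smul_one_sub_of_partition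
    (Sum.elim (fun i => if i.val < k + 1 then (0 : Fin 3) else 1) (fun _ => 2))
    !![1, 1, 1; 1, 1, 0; 1, 0, 0] ![1, 1, 0] x ?hx _ ?hA ![k + 1, r + 2, q + 1] ?hN]
  · have : x + 1 ≠ 0 := by positivity
    rw [show k + 1 + 2 + r - 2 = k + 1 + r by omega]
    simp [det_fin_three, Fin.prod_univ_three, pineappleCubic]
    field_simp
    ring
  case hx =>
    intro s; fin_cases s <;> simp <;> positivity
  case hA =>
    rintro (i | i) (j | j)
    · by_cases h : i = j
      · subst h
        by_cases hi : i.val ≤ k <;> simp [hi, SimpleGraph.adjMatrix_apply]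
      · by_cases hi : i.val ≤ k <;> by_cases hj : j.val ≤ k <;>
          simp [h, hi, hj, SimpleGraph.adjMatrix_apply]
    · by_cases hi : i.val ≤ k <;> simp [hi, SimpleGraph.adjMatrix_apply]
    · by_cases hj : j.val ≤ k <;> simp [hj, SimpleGraph.adjMatrix_apply]
    · simp [SimpleGraph.adjMatrix_apply]
  case hN =>
    have h0 : (Finset.univ.filter fun i : Fin (k + 1 + 2 + r) => i.val < k + 1).card = k + 1 := by
      rw [Fin.card_filter_val_lt]; omega
    have h1 : (Finset.univ.filter fun i : Fin (k + 1 + 2 + r) => ¬ i.val < k + 1).card =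
        r + 2 := by
      have := Finset.card_filter_add_card_filter_not (s := Finset.univ)
        (fun i : Fin (k + 1 + 2 + r) => i.val < k + 1)
      rw [h0, Finset.card_univ, Fintype.card_fin] at this
      omega
    have h2 (i : Fin (k + 1 + 2 + r)) : (if i.val < k + 1 then (0 : Fin 3) else 1) ≠ 2 := by
      split_ifs <;> decide
    have h3 (i : Fin (k + 1 + 2 + r)) :
        (if i.val < k + 1 then (0 : Fin 3) else 1) = 0 ↔ i.val < k + 1 := by
      split_ifs with h <;> simp [h]
    have h4 (i : Fin (k + 1 + 2 + r)) :
        (if i.val < k + 1 then (0 : Fin 3) else 1) = 1 ↔ ¬ i.val < k + 1 := by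
      split_ifs with h <;> simp [h]
    intro s
    fin_cases s <;>
      simp only [card_filter_sum, Sum.elim_inl, Sum.elim_inr, Fin.zero_eta, Fin.mk_one,
        Fin.reduceFinMk, h2, h3, h4, h0, h1] <;> simp

/-! ### Location of the roots of the pineapple cubic -/

theorem splits_pineappleCubic (p k q : ℕ) (hk : 1 ≤ k) (hkp : k + 2 ≤ p) (hq : 1 ≤ q) :
    (pineappleCubic p k q).Splits := by
  have := adjCharpoly_splits (genPineapple p k q)
  have h0 := (adjCharpoly_monic (genPineapple p k q)).ne_zero
  rw [adjCharpoly_genPineapple p k q hk hkp hq] at this h0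
  exact this.of_dvd h0 (dvd_mul_left _ _)

theorem exists_roots_pineappleCubic (p k q : ℕ) (hk : 1 ≤ k) (hkp : k + 2 ≤ p) (hq : 1 ≤ q) :
    ∃ r s u : ℝ, pineappleCubic p k q = (X - C r) * (X - C s) * (X - C u) := by
  have hs := splits_pineappleCubic p k q hk hkp hq
  have hd : (pineappleCubic p k q).natDegree = 3 := by
    unfold pineappleCubic; compute_degree!
  have hm : (pineappleCubic p k q).Monic := by
    unfold pineappleCubic; monicity!
  have hc := hs.natDegree_eq_card_roots
  rw [hd] at hc
  obtain ⟨r, s, u, h⟩ := Multiset.card_eq_three.1 hc.symm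
  refine ⟨r, s, u, ?_⟩
  rw [hs.eq_prod_roots_of_monic hm, h]
  simp [mul_assoc]

/-- Two roots below -1 would, by the sign of the product, force the third below -1 too, against the
positive sum. -/
theorem not_two_lt_neg_one {r s u c : ℝ} (hc : 0 < c) (h : (r + 1) * (s + 1) * (u + 1) = -c)
    (hsum : 0 < r + s + u) (hr : r < -1) : ¬ s < -1 := fun hs => by
  have h1 : 0 < (r + 1) * (s + 1) := mul_pos_of_neg_of_neg (by linarith) (by linarith)
  have h2 : u + 1 < 0 := by
    by_contra! hu
    linarith [mul_nonneg h1.le hu]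
  linarith

theorem countP_adjSpectrum_genPineapple (p k q : ℕ) (hk : 1 ≤ k) (hkp : k + 2 ≤ p)
    (hq : 1 ≤ q) :
    (adjSpectrum (genPineapple p k q)).countP (0 < ·) ≤ 2 ∧
      (adjSpectrum (genPineapple p k q)).countP (· < -1) ≤ 1 := by
  obtain ⟨r, s, u, h⟩ := exists_roots_pineappleCubic p k q hk hkp hq
  have h0 := congrArg (eval 0) h
  have h1 := congrArg (eval (-1)) h
  have h2 := congrArg (eval 1) h
  have hk' : (1 : ℝ) ≤ k := by exact_mod_cast hk
  have hq' : (1 : ℝ) ≤ q := by exact_mod_cast hq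
  have hp' : (k : ℝ) + 2 ≤ p := by exact_mod_cast hkp
  have key : adjSpectrum (genPineapple p k q) =
      (p - 2) • {-1} + (q - 1) • {0} + {r, s, u} := by
    have e : adjCharpoly (genPineapple p k q) =
        (Multiset.map (fun a => X - C a) ((p - 2) • {-1} + (q - 1) • {0} + {r, s, u})).prod := by
      rw [adjCharpoly_genPineapple p k q hk hkp hq, h]
      simp [Multiset.map_nsmul, Multiset.prod_nsmul]
      ring
    rw [adjSpectrum_eq_roots, e, roots_multiset_prod_X_sub_C]
  simp only [pineappleCubic, eval_sub, eval_mul, eval_X, eval_C, eval_pow] at h0 h1 h2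
  -- The product, the shifted product and the sum of the roots come from the values at 0, -1 and 1.
  have e0 : r * s * u = - ((p - k - 1) * (q * k)) := by linarith
  have e1 : (r + 1) * (s + 1) * (u + 1) = -((p - k) * k * q) := by linarith
  have e2 : r + s + u = p - 2 := by linarith
  have hc : 0 < ((p : ℝ) - k) * k * q :=
    mul_pos (mul_pos (by linarith) (by linarith)) (by linarith)
  have hsum : 0 < r + s + u := by linarith
  rw [key]
  constructor
  · have hpos : ¬ (0 < r ∧ 0 < s ∧ 0 < u) := fun ⟨hr, hs, hu⟩ => by
      have := mul_pos (mul_pos hr hs) hu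
      have : 0 < ((p : ℝ) - k - 1) * (q * k) :=
        mul_pos (by linarith) (mul_pos (by linarith) (by linarith))
      linarith
    simp only [Multiset.countP_add, Multiset.countP_nsmul, Multiset.insert_eq_cons,
      Multiset.countP_cons, ← Multiset.cons_zero, Multiset.countP_zero]
    norm_num
    split_ifs <;> simp_all
  · have hrs := not_two_lt_neg_one hc e1 hsum
    have hsu := not_two_lt_neg_one (r := s) (s := u) (u := r) hc (by linarith) (by linarith)
    have hur := not_two_lt_neg_one (r := u) (s := r) (u := s) hc (by linarith) (by linarith)
    simp only [Multiset.countP_add, Multiset.countP_nsmul, Multiset.insert_eq_cons,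
      Multiset.countP_cons, ← Multiset.cons_zero, Multiset.countP_zero]
    norm_num
    split_ifs <;> simp_all

/-! ### Forbidden induced configurations -/

section ForbiddenSubgraphs

variable {V : Type*} [Fintype V] {G : SimpleGraph V}

theorem one_le_countP_pos_of_adj {u v : V} (h : G.Adj u v) :
    1 ≤ (adjSpectrum G).countP (0 < ·) := by
  classical
  refine one_le_countP_pos_adjSpectrum G (Pi.single u 1 + Pi.single v 1) ?_
  simp [mulVec_add, SimpleGraph.adjMatrix_apply, h, h.symm]

theorem two_le_countP_pos_of_not_adj {u v w z : V} (huw : G.Adj u w) (hu : ¬ G.Adj v u)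
    (hw : ¬ G.Adj v w) (hz : G.Adj v z) : 2 ≤ (adjSpectrum G).countP (0 < ·) := by
  classical
  -- The two diagonal values are 2 and 4, and the mixed value is at most 2, so 4 < 8. Weight 1 on v
  -- would only give 4 ≤ 4.
  refine two_le_countP_pos_adjSpectrum G (Pi.single u 1 + Pi.single w 1)
    (Pi.single z 1 + (2 : ℝ) • Pi.single v 1) ?_ ?_
  · simp [mulVec_add, SimpleGraph.adjMatrix_apply, huw, huw.symm]
  · have hu' : ¬ G.Adj u v := fun h => hu h.symm
    have hw' : ¬ G.Adj w v := fun h => hw h.symm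
    simp [mulVec_add, mulVec_smul, SimpleGraph.adjMatrix_apply, huw, huw.symm, hu', hw', hz,
      hz.symm]
    split_ifs <;> norm_num

theorem one_le_countP_lt_neg_one_of_path {u v w : V} (huv : G.Adj u v) (hvw : G.Adj v w)
    (hne : u ≠ w) (huw : ¬ G.Adj u w) : 1 ≤ (adjSpectrum G).countP (· < -1) := by
  classical
  -- On (1, -1, 1) the form of A + I equals -4 + 3 = -1.
  refine one_le_countP_lt_neg_one_adjSpectrum G
    (Pi.single u 1 + Pi.single w 1 - Pi.single v 1) ?_
  have huw' : ¬ G.Adj w u := fun h => huw h.symm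
  simp [mulVec_add, mulVec_sub, SimpleGraph.adjMatrix_apply, huv, huv.symm, hvw, hvw.symm, huw,
    huw', hne, hne.symm, huv.ne, huv.ne', hvw.ne, hvw.ne']
  norm_num

/-- `K_{2,2,1}` has two eigenvalues less than `-1`. -/
theorem two_le_countP_lt_neg_one {a a' b b' c : V} (ha : a ≠ a') (hna : ¬ G.Adj a a')
    (hb : b ≠ b') (hnb : ¬ G.Adj b b') (h1 : G.Adj a b) (h2 : G.Adj a b') (h3 : G.Adj a' b)
    (h4 : G.Adj a' b') (hca : G.Adj c a) (hca' : G.Adj c a') (hcb : G.Adj c b)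
    (hcb' : G.Adj c b') : 2 ≤ (adjSpectrum G).countP (· < -1) := by
  classical
  have hna' : ¬ G.Adj a' a := fun h => hna h.symm
  have hnb' : ¬ G.Adj b' b := fun h => hnb h.symm
  -- These vectors are orthogonal for A + I, with value -4 on each.
  refine two_le_countP_lt_neg_one_adjSpectrum G
    (Pi.single a 1 + Pi.single a' 1 - Pi.single b 1 - Pi.single b' 1)
    (Pi.single a 1 + Pi.single a' 1 + Pi.single b 1 + Pi.single b' 1 - (4 : ℝ) • Pi.single c 1)
    ?_ ?_
  · simp [mulVec_add, mulVec_sub, SimpleGraph.adjMatrix_apply, *, SimpleGraph.adj_comm,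
      h1.ne, h1.ne', h2.ne, h2.ne', h3.ne, h3.ne', h4.ne, h4.ne', ha.symm, hb.symm]
    norm_num
  · simp [mulVec_add, mulVec_sub, mulVec_smul, SimpleGraph.adjMatrix_apply, *,
      h1.ne, h1.ne', h2.ne, h2.ne', h3.ne, h3.ne', h4.ne, h4.ne', ha.symm, hb.symm,
      h1.symm, h2.symm, h3.symm, h4.symm, hca.symm, hca'.symm, hcb.symm, hcb'.symm,
      hca.ne, hca.ne', hca'.ne, hca'.ne', hcb.ne, hcb.ne', hcb'.ne, hcb'.ne']
    norm_num

end ForbiddenSubgraphs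

/-! ### Graphs with few positive eigenvalues and few below -1 -/

section Classification

variable {V : Type*} [Fintype V] {G : SimpleGraph V}

/-- Without induced paths on three vertices, every walk from u shortcuts to an edge or returns to u.
-/
theorem adj_of_countP_lt_neg_one_eq_zero (hG : G.Connected)
    (h : (adjSpectrum G).countP (· < -1) = 0) {u v : V} (huv : u ≠ v) : G.Adj u v := by
  have key : ∀ w, Relation.ReflTransGen G.Adj u w → u = w ∨ G.Adj u w := by
    intro w hw
    induction hw with
    | refl => exact .inl rfl
    | @tail b c _ hbc ih =>
      rcases ih with rfl | ih
      · exact .inr hbc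
      · by_contra! hc
        have := one_le_countP_lt_neg_one_of_path ih hbc hc.1 hc.2
        omega
  exact (key v ((SimpleGraph.reachable_iff_reflTransGen u v).1 (hG.preconnected u v))).resolve_left
    huv

theorem nonempty_iso_top (h : ∀ u v : V, u ≠ v → G.Adj u v) :
    Nonempty (G ≃g (⊤ : SimpleGraph (Fin (Fintype.card V)))) :=
  ⟨⟨Fintype.equivFin V, fun {u v} => by
    simpa using ⟨h u v, fun h => h.ne⟩⟩⟩

theorem exists_equiv_fin_sum_fin (P : V → Prop) :
    ∃ (m n : ℕ) (e : V ≃ Fin m ⊕ Fin n), (∀ v, P v → ∃ i, e v = .inl i) ∧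
      ∀ v, ¬ P v → ∃ i, e v = .inr i := by
  classical
  refine ⟨_, _, (Equiv.sumCompl P).symm.trans
    (Equiv.sumCongr (Fintype.equivFin _) (Fintype.equivFin _)), fun v hv => ?_, fun v hv => ?_⟩
  · exact ⟨Fintype.equivFin _ ⟨v, hv⟩, by simp [Equiv.sumCompl_symm_apply_of_pos hv]⟩
  · exact ⟨Fintype.equivFin _ ⟨v, hv⟩, by simp [Equiv.sumCompl_symm_apply_of_neg hv]⟩

theorem exists_iso_completeSplit (P : V → Prop) (hP : ∃ v, P v) (hN : ∃ v, ¬ P v)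
    (h1 : ∀ u v, P u → u ≠ v → G.Adj u v) (h2 : ∀ u v, ¬ P u → ¬ P v → ¬ G.Adj u v) :
    ∃ m n : ℕ, 1 ≤ m ∧ 1 ≤ n ∧ Nonempty (G ≃g completeSplit m n) := by
  obtain ⟨m, n, e, hl, hr⟩ := exists_equiv_fin_sum_fin P
  refine ⟨m, n, ?_, ?_, ⟨⟨e, fun {u v} => ?_⟩⟩⟩
  · obtain ⟨v, hv⟩ := hP
    obtain ⟨i, -⟩ := hl v hv
    exact i.pos
  · obtain ⟨v, hv⟩ := hN
    obtain ⟨i, -⟩ := hr v hv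
    exact i.pos
  · by_cases hu : P u <;> by_cases hv : P v
    · obtain ⟨i, hi⟩ := hl u hu
      obtain ⟨j, hj⟩ := hl v hv
      have hij : i = j ↔ u = v := by rw [← e.apply_eq_iff_eq, hi, hj, Sum.inl.injEq]
      rw [hi, hj, completeSplit_adj_inl_inl, Ne, hij]
      exact ⟨h1 u v hu, fun h => h.ne⟩
    · obtain ⟨i, hi⟩ := hl u hu
      obtain ⟨j, hj⟩ := hr v hv
      rw [hi, hj]
      exact iff_of_true completeSplit_adj_inl_inr (h1 u v hu fun h => hv (h ▸ hu))
    · obtain ⟨i, hi⟩ := hr u hu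
      obtain ⟨j, hj⟩ := hl v hv
      rw [hi, hj]
      exact iff_of_true completeSplit_adj_inr_inl (h1 v u hv fun h => hu (h ▸ hv)).symm
    · obtain ⟨i, hi⟩ := hr u hu
      obtain ⟨j, hj⟩ := hr v hv
      rw [hi, hj]
      exact iff_of_false not_completeSplit_adj_inr_inr (h2 u v hu hv)

theorem exists_iso_completeBipartiteGraph (P : V → Prop) (hP : ∃ v, P v) (hN : ∃ v, ¬ P v)
    (h : ∀ u v, G.Adj u v ↔ ¬ (P u ↔ P v)) :
    ∃ m n : ℕ, 1 ≤ m ∧ 1 ≤ n ∧ Nonempty (G ≃g completeBipartiteGraph (Fin m) (Fin n)) := by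
  obtain ⟨m, n, e, hl, hr⟩ := exists_equiv_fin_sum_fin P
  refine ⟨m, n, ?_, ?_, ⟨⟨e, fun {u v} => ?_⟩⟩⟩
  · obtain ⟨v, hv⟩ := hP
    obtain ⟨i, -⟩ := hl v hv
    exact i.pos
  · obtain ⟨v, hv⟩ := hN
    obtain ⟨i, -⟩ := hr v hv
    exact i.pos
  · have key : ∀ w, (e w).isLeft = true ↔ P w := fun w => by
      by_cases hw : P w
      · obtain ⟨i, hi⟩ := hl w hw
        simp [hi, hw]
      · obtain ⟨i, hi⟩ := hr w hw
        simp [hi, hw]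
    rw [h, ← key u, ← key v]
    cases e u <;> cases e v <;> simp

theorem exists_iso_completeSplit_or_completeBipartiteGraph (hG : G.Connected) [Nontrivial V]
    (hpos : (adjSpectrum G).countP (0 < ·) ≤ 1) (hneg : (adjSpectrum G).countP (· < -1) ≤ 1) :
    (∃ m n : ℕ, 1 ≤ m ∧ 1 ≤ n ∧ Nonempty (G ≃g completeSplit m n)) ∨
      ∃ m n : ℕ, 1 ≤ m ∧ 1 ≤ n ∧ Nonempty (G ≃g completeBipartiteGraph (Fin m) (Fin n)) := by
  have trans : ∀ {u v w}, ¬ G.Adj u v → ¬ G.Adj v w → ¬ G.Adj u w := fun {u v w} huv hvw huw => by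
    obtain ⟨z, hz⟩ := hG.preconnected.exists_adj_of_nontrivial v
    have := two_le_countP_pos_of_not_adj huw (fun h => huv h.symm) hvw hz
    omega
  -- The classes of non-adjacency are the parts. The question is whether two different parts both
  -- have at least two vertices.
  by_cases hA : ∃ a a' b b', a ≠ a' ∧ ¬ G.Adj a a' ∧ b ≠ b' ∧ ¬ G.Adj b b' ∧ G.Adj a b
  · right
    obtain ⟨a, a', b, b', ha, hna, hb, hnb, hab⟩ := hA
    have hnb' : ¬ G.Adj b' b := fun h => hnb h.symm
    have hab' : G.Adj a b' := by
      by_contra h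
      exact trans h hnb' hab
    have ha'b : G.Adj a' b := by
      by_contra h
      exact trans hna h hab
    have ha'b' : G.Adj a' b' := by
      by_contra h
      exact trans hna h hab'
    -- A vertex in a third part would complete a `K_{2,2,1}`.
    have cover : ∀ c, G.Adj c a → ¬ G.Adj c b := fun c hca hcb => by
      have hca' : G.Adj c a' := by
        by_contra h
        exact trans h (fun h => hna h.symm) hca
      have hcb' : G.Adj c b' := by
        by_contra h
        exact trans h hnb' hcb
      have := two_le_countP_lt_neg_one ha hna hb hnb hab hab' ha'b ha'b' hca hca' hcb hcb'
      omega
    refine exists_iso_completeBipartiteGraph (fun c => ¬ G.Adj c a) ⟨a, G.irrefl⟩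
      ⟨b, fun h => h hab.symm⟩ fun u v => ?_
    by_cases hu : G.Adj u a <;> by_cases hv : G.Adj v a <;>
      simp only [hu, hv, not_true_eq_false, not_false_eq_true, iff_true,
        iff_false]
    · exact trans (cover u hu) fun h => cover v hv h.symm
    · by_contra h
      exact trans h hv hu
    · by_contra h
      exact trans (fun h' => h h'.symm) hu hv
    · exact trans hu fun h => hv h.symm
  · left
    push Not at hA
    -- A complete graph counts as complete split with a single independent vertex.
    by_cases hd : ∀ u v : V, u ≠ v → G.Adj u v
    · obtain ⟨u, v, huv⟩ := exists_pair_ne V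
      refine exists_iso_completeSplit (fun w => w ≠ u) ⟨v, huv.symm⟩ ⟨u, fun h => h rfl⟩
        (fun x y _ => hd x y) fun x y hx hy => ?_
      rw [not_not] at hx hy
      rw [hx, hy]
      exact G.irrefl
    · push Not at hd
      obtain ⟨u, v, huv, hnuv⟩ := hd
      obtain ⟨z, hz⟩ := hG.preconnected.exists_adj_of_nontrivial u
      refine exists_iso_completeSplit (fun x => ∀ y, x ≠ y → G.Adj x y) ⟨z, fun y hy => ?_⟩
        ⟨u, fun h => hnuv (h v huv)⟩ (fun x y hx => hx y) fun x y hx hy => ?_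
      · by_contra h
        exact hA u v z y huv hnuv hy h hz
      · push Not at hx hy
        obtain ⟨x', hxx', hx⟩ := hx
        obtain ⟨y', hyy', hy⟩ := hy
        exact hA x x' y y' hxx' hx hyy' hy

end Classification

/-! ### Comparison of characteristic polynomials -/

section Arithmetic

theorem Polynomial.X_pow_mul_eq_X_pow_mul {F G : ℝ[X]} {i j : ℕ} (hF : F.eval 0 ≠ 0)
    (hG : G.eval 0 ≠ 0) (h : X ^ i * F = X ^ j * G) : i = j ∧ F = G := by
  have aux : ∀ {F G : ℝ[X]} {i j : ℕ}, F.eval 0 ≠ 0 → X ^ i * F = X ^ j * G → j ≤ i := by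
    intro F G i j hF h
    by_contra! hij
    obtain ⟨d, rfl⟩ := Nat.exists_eq_add_of_lt hij
    rw [show i + d + 1 = i + (d + 1) by ring, pow_add, mul_assoc] at h
    have := mul_left_cancel₀ (pow_ne_zero i X_ne_zero) h
    rw [this] at hF
    simp at hF
  have hij : i = j := le_antisymm (aux hG h.symm) (aux hF h)
  subst hij
  exact ⟨rfl, mul_left_cancel₀ (pow_ne_zero i X_ne_zero) h⟩

variable {p k q a t m n : ℕ}

/-- With D = p + q - a - k - 1, n = q - a, and tD, mD equal to the numerators in (iv), the right
side is D²(qk - m(n - t)). -/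
theorem root_equation_eq (p k q a : ℤ) :
    k * a ^ 3 + (p - p ^ 2 + k * p + (1 - 2 * q) * k) * a ^ 2
      + ((2 * q - 1) * p ^ 2 - 4 * p * q * k + p * k + (1 - 2 * q) * p + 2 * q * k ^ 2
        + q ^ 2 * k) * a
      + (k + 1 - q) * p ^ 2 * q + ((3 * q - 3) * k - 2 * k ^ 2 + q - 1) * p * q
      + q * k ^ 3 + 2 * (1 - q) * q * k ^ 2 + (1 - q) * q * k =
    q * k * (p + q - a - k - 1) ^ 2 - (p ^ 2 - (k + 1) * p + k * q - k * a) *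
      ((q - a) * (p + q - a - k - 1) - (q - a) * (p - k)) := by
  ring

theorem eval_zero_pineappleCubic :
    (pineappleCubic p k q).eval 0 = (p - k - 1) * (q * k) := by
  simp [pineappleCubic]
  ring

theorem eval_neg_one_pineappleCubic :
    (pineappleCubic p k q).eval (-1) = (p - k) * k * q := by
  simp [pineappleCubic]
  ring

theorem eval_zero_pineappleCubic_ne_zero (hk : 1 ≤ k) (hkp : k + 2 ≤ p) (hq : 1 ≤ q) :
    (pineappleCubic p k q).eval 0 ≠ 0 := by
  rw [eval_zero_pineappleCubic]
  have hk' : (1 : ℝ) ≤ k := by exact_mod_cast hk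
  have hq' : (1 : ℝ) ≤ q := by exact_mod_cast hq
  have hp' : (k : ℝ) + 2 ≤ p := by exact_mod_cast hkp
  exact (mul_pos (by linarith) (mul_pos (by linarith) (by linarith))).ne'

/-- The spectral conditions for `K_t ∪ CS_{m,n} ∪ aK₁` to be cospectral with `K_{p,k}^q`. -/
theorem cospectral_completeSplit_iff (hk : 1 ≤ k) (hkp : k + 2 ≤ p) (hq : 1 ≤ q) (ht : 2 ≤ t)
    (hm : 1 ≤ m) (hn : 1 ≤ n) :
    Cospectral (((⊤ : SimpleGraph (Fin t)) ⊕g completeSplit m n) ⊕g (⊥ : SimpleGraph (Fin a)))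
      (genPineapple p k q) ↔
    (n : ℤ) = q - a ∧ (t : ℤ) + m = p ∧ (q : ℤ) * k = m * (n - t) ∧
      ((p : ℤ) - k - 1) * (q * k) = (t - 1) * (m * n) := by
  rw [cospectral_iff_adjCharpoly_eq]
  have hG : adjCharpoly (((⊤ : SimpleGraph (Fin t)) ⊕g completeSplit m n) ⊕g
      (⊥ : SimpleGraph (Fin a))) = X ^ (n - 1 + a) * ((X + 1) ^ (t - 1 + (m - 1)) *
        ((X - C ((t : ℝ) - 1)) * (X ^ 2 - C ((m : ℝ) - 1) * X - C ((m : ℝ) * n)))) := by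
    rw [adjCharpoly_sum, adjCharpoly_sum, adjCharpoly_top t (by omega),
      adjCharpoly_completeSplit m n hm hn, adjCharpoly_bot, Fintype.card_fin, pow_add, pow_add]
    ring
  have hP : adjCharpoly (genPineapple p k q) =
      X ^ (q - 1) * ((X + 1) ^ (p - 2) * pineappleCubic p k q) := by
    rw [adjCharpoly_genPineapple p k q hk hkp hq]
    ring
  constructor
  · intro h
    have hcard := congrArg natDegree h
    simp only [natDegree_adjCharpoly, Fintype.card_sum, Fintype.card_fin] at hcard
    rw [hG, hP] at h
    have ht' : (2 : ℝ) ≤ t := by exact_mod_cast ht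
    have hm' : (1 : ℝ) ≤ m := by exact_mod_cast hm
    have hn' : (1 : ℝ) ≤ n := by exact_mod_cast hn
    obtain ⟨hq', h⟩ := X_pow_mul_eq_X_pow_mul (by
      have : 0 < (t - 1 : ℝ) * (m * n) := mul_pos (by linarith) (by positivity)
      simp only [eval_mul, eval_pow, eval_add, eval_sub, eval_X, eval_one, eval_C, zero_add,
        one_pow, one_mul]
      nlinarith) (by
      simpa using eval_zero_pineappleCubic_ne_zero hk hkp hq) h
    rw [show t - 1 + (m - 1) = p - 2 by omega] at h
    have h := mul_left_cancel₀ (pow_ne_zero _ (X_add_C_ne_zero (1 : ℝ))) h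
    have h0 := congrArg (eval 0) h
    have h1 := congrArg (eval (-1)) h
    rw [eval_zero_pineappleCubic] at h0
    rw [eval_neg_one_pineappleCubic] at h1
    simp only [eval_mul, eval_pow, eval_sub, eval_X, eval_C] at h0 h1
    -- The third equation is the difference of the values at -1 and 0; the fourth is the value at 0.
    refine ⟨by omega, by omega, ?_, ?_⟩
    · rify
      linear_combination h0 - h1
    · rify
      linear_combination -h0
  · rintro ⟨hna, htm, h1, h2⟩
    rw [hG, hP, show n - 1 + a = q - 1 by omega, show t - 1 + (m - 1) = p - 2 by omega]
    congr 2
    rify at htm h1 h2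
    refine Polynomial.funext fun x => ?_
    simp only [pineappleCubic, eval_mul, eval_pow, eval_sub, eval_X, eval_C]
    linear_combination (-x ^ 2 - x) * htm + x * h1 - h2

theorem not_cospectral_completeBipartiteGraph (hk : 1 ≤ k) (hkp : k + 2 ≤ p) (hq : 1 ≤ q)
    (ht : 2 ≤ t) (hm : 1 ≤ m) (hn : 1 ≤ n) :
    ¬ Cospectral (((⊤ : SimpleGraph (Fin t)) ⊕g completeBipartiteGraph (Fin m) (Fin n)) ⊕g
      (⊥ : SimpleGraph (Fin a))) (genPineapple p k q) := by
  rw [cospectral_iff_adjCharpoly_eq]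
  intro h
  have hcard := congrArg natDegree h
  simp only [natDegree_adjCharpoly, Fintype.card_sum, Fintype.card_fin] at hcard
  have hG : adjCharpoly (((⊤ : SimpleGraph (Fin t)) ⊕g completeBipartiteGraph (Fin m) (Fin n)) ⊕g
      (⊥ : SimpleGraph (Fin a))) = X ^ (m + n - 2 + a) * ((X + 1) ^ (t - 1) *
        ((X - C ((t : ℝ) - 1)) * (X ^ 2 - C ((m : ℝ) * n)))) := by
    rw [adjCharpoly_sum, adjCharpoly_sum, adjCharpoly_top t (by omega),
      adjCharpoly_completeBipartiteGraph m n hm hn, adjCharpoly_bot, Fintype.card_fin, pow_add]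
    ring
  have hP : adjCharpoly (genPineapple p k q) =
      X ^ (q - 1) * ((X + 1) ^ (p - 2) * pineappleCubic p k q) := by
    rw [adjCharpoly_genPineapple p k q hk hkp hq]
    ring
  rw [hG, hP] at h
  have ht' : (2 : ℝ) ≤ t := by exact_mod_cast ht
  have hm' : (1 : ℝ) ≤ m := by exact_mod_cast hm
  have hn' : (1 : ℝ) ≤ n := by exact_mod_cast hn
  have hk' : (1 : ℝ) ≤ k := by exact_mod_cast hk
  have hq' : (1 : ℝ) ≤ q := by exact_mod_cast hq
  obtain ⟨hq', h⟩ := X_pow_mul_eq_X_pow_mul (by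
    have : 0 < (t - 1 : ℝ) * (m * n) := mul_pos (by linarith) (by positivity)
    simp only [eval_mul, eval_pow, eval_add, eval_sub, eval_X, eval_one, eval_C, zero_add,
      one_pow, one_mul]
    nlinarith) (by
    simpa using eval_zero_pineappleCubic_ne_zero hk hkp hq) h
  -- The vertex count together with the multiplicity of 0 fixes p.
  have htp : p = t + 1 := by omega
  rw [show t - 1 = p - 2 by omega] at h
  have h := mul_left_cancel₀ (pow_ne_zero _ (X_add_C_ne_zero (1 : ℝ))) h
  have h0 := congrArg (eval 0) h
  have h1 := congrArg (eval (-1)) h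
  rw [eval_zero_pineappleCubic] at h0
  rw [eval_neg_one_pineappleCubic] at h1
  simp only [eval_mul, eval_pow, eval_sub, eval_X, eval_C, htp, Nat.cast_add, Nat.cast_one]
    at h0 h1
  -- Eliminating mn = qk + t between the values at 0 and -1 leaves a positive term plus a
  -- nonnegative one.
  have h2 : (t - 1 : ℝ) * t + (k - 1) * (q * k) = 0 := by
    linear_combination h0 - (t - 1) * (h1 - h0)
  have h3 : 0 < (t - 1 : ℝ) * t := mul_pos (by linarith) (by linarith)
  have h4 : 0 ≤ (k - 1 : ℝ) * (q * k) := mul_nonneg (by linarith) (by positivity)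
  linarith

end Arithmetic

/-! ### Structure of cospectral mates -/

section Structure

theorem Cospectral.congr_iso {V W U : Type*} [Fintype V] [Fintype W] [Fintype U]
    {G : SimpleGraph V} {H : SimpleGraph W} {K : SimpleGraph U} (e : G ≃g H) :
    Cospectral G K ↔ Cospectral H K := by
  rw [cospectral_iff_adjCharpoly_eq, cospectral_iff_adjCharpoly_eq, e.adjCharpoly_eq]

variable {p k q a : ℕ} {V₁ V₂ : Type*} [Fintype V₁] [Fintype V₂]
  {G₁ : SimpleGraph V₁} {G₂ : SimpleGraph V₂}

theorem exists_iso_of_cospectral_of_countP_eq_zero (hk : 1 ≤ k) (hkp : k + 2 ≤ p) (hq : 1 ≤ q)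
    (hG₁ : G₁.Connected) [Nontrivial V₁] (hG₂ : G₂.Connected) [Nontrivial V₂]
    (h : Cospectral ((G₁ ⊕g G₂) ⊕g (⊥ : SimpleGraph (Fin a))) (genPineapple p k q))
    (h₁ : (adjSpectrum G₁).countP (· < -1) = 0) (hpos : (adjSpectrum G₂).countP (0 < ·) ≤ 1)
    (hneg : (adjSpectrum G₂).countP (· < -1) ≤ 1) :
    ∃ t m n : ℕ, 2 ≤ t ∧ 1 ≤ m ∧ 1 ≤ n ∧ Nonempty (((G₁ ⊕g G₂) ⊕g (⊥ : SimpleGraph (Fin a))) ≃g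
      (((⊤ : SimpleGraph (Fin t)) ⊕g completeSplit m n) ⊕g (⊥ : SimpleGraph (Fin a)))) := by
  obtain ⟨e₁⟩ := nonempty_iso_top fun u v => adj_of_countP_lt_neg_one_eq_zero hG₁ h₁ (u := u) (v := v)
  have ht : 2 ≤ Fintype.card V₁ := Fintype.one_lt_card
  rcases exists_iso_completeSplit_or_completeBipartiteGraph hG₂ hpos hneg with
    ⟨m, n, hm, hn, ⟨e₂⟩⟩ | ⟨m, n, hm, hn, ⟨e₂⟩⟩
  · exact ⟨_, m, n, ht, hm, hn, ⟨.sumCongr (.sumCongr e₁ e₂) .refl⟩⟩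
  · exact absurd ((Cospectral.congr_iso (.sumCongr (.sumCongr e₁ e₂) .refl)).1 h)
      (not_cospectral_completeBipartiteGraph hk hkp hq ht hm hn)

theorem one_le_countP_pos (hG₁ : G₁.Connected) [Nontrivial V₁] :
    1 ≤ (adjSpectrum G₁).countP (0 < ·) := by
  obtain ⟨v⟩ := hG₁.nonempty
  obtain ⟨w, hw⟩ := hG₁.preconnected.exists_adj_of_nontrivial v
  exact one_le_countP_pos_of_adj hw

theorem exists_iso_of_cospectral (hk : 1 ≤ k) (hkp : k + 2 ≤ p) (hq : 1 ≤ q)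
    (hG₁ : G₁.Connected) [Nontrivial V₁] (hG₂ : G₂.Connected) [Nontrivial V₂]
    (h : Cospectral ((G₁ ⊕g G₂) ⊕g (⊥ : SimpleGraph (Fin a))) (genPineapple p k q)) :
    ∃ t m n : ℕ, 2 ≤ t ∧ 1 ≤ m ∧ 1 ≤ n ∧ Nonempty (((G₁ ⊕g G₂) ⊕g (⊥ : SimpleGraph (Fin a))) ≃g
      (((⊤ : SimpleGraph (Fin t)) ⊕g completeSplit m n) ⊕g (⊥ : SimpleGraph (Fin a)))) := by
  obtain ⟨hpos, hneg⟩ := countP_adjSpectrum_genPineapple p k q hk hkp hq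
  rw [← h, adjSpectrum_sum, adjSpectrum_sum, Multiset.countP_add, Multiset.countP_add] at hpos hneg
  have p₁ := one_le_countP_pos hG₁
  have p₂ := one_le_countP_pos hG₂
  by_cases h₁ : (adjSpectrum G₁).countP (· < -1) = 0
  · exact exists_iso_of_cospectral_of_countP_eq_zero hk hkp hq hG₁ hG₂ h h₁ (by omega) (by omega)
  -- G₁ now uses up the only eigenvalue below -1, so G₂ is the complete component.
  · have e : ((G₁ ⊕g G₂) ⊕g (⊥ : SimpleGraph (Fin a))) ≃g ((G₂ ⊕g G₁) ⊕g ⊥) :=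
      .sumCongr .sumComm .refl
    obtain ⟨t, m, n, ht, hm, hn, ⟨e'⟩⟩ := exists_iso_of_cospectral_of_countP_eq_zero hk hkp hq hG₂
      hG₁ ((Cospectral.congr_iso e).1 h) (by omega) (by omega) (by omega)
    exact ⟨t, m, n, ht, hm, hn, ⟨e'.comp e⟩⟩

end Structure

/-! ### The main equivalence -/

theorem theorem3p1 (p k q : ℕ) (hk : 1 ≤ k) (hkp : k + 2 ≤ p) (hq : 1 ≤ q) (a : ℕ)
    {V V₁ V₂ : Type*} [Fintype V] [Fintype V₁] [Fintype V₂]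
    (G : SimpleGraph V) (G₁ : SimpleGraph V₁) (G₂ : SimpleGraph V₂)
    -- `G₁` and `G₂` are connected with at least one edge
    (hG₁ : G₁.Connected) (hV₁ : Nontrivial V₁) (hG₂ : G₂.Connected) (hV₂ : Nontrivial V₂)
    -- `G = G₁ ∪ G₂ ∪ a K₁`
    (hG : Nonempty (G ≃g ((G₁ ⊕g G₂) ⊕g (⊥ : SimpleGraph (Fin a))))) :
    Cospectral G (genPineapple p k q) ↔
      -- `a` is a root of the cubic
      ((k : ℤ) * (a : ℤ) ^ 3
          + (p - p ^ 2 + k * p + (1 - 2 * q) * k) * (a : ℤ) ^ 2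
          + ((2 * q - 1) * p ^ 2 - 4 * p * q * k + p * k + (1 - 2 * q) * p + 2 * q * k ^ 2
              + q ^ 2 * k) * (a : ℤ)
          + (k + 1 - q) * p ^ 2 * q + ((3 * q - 3) * k - 2 * k ^ 2 + q - 1) * p * q
          + q * k ^ 3 + 2 * (1 - q) * q * k ^ 2 + (1 - q) * q * k = 0) ∧
      (a : ℤ) < (q : ℤ) - 1 ∧
      ((p : ℤ) + q - k - 1 - a) ∣ ((q : ℤ) - a) * ((p : ℤ) - k) ∧
      ∃ t m n : ℕ,
        (n : ℚ) = (q : ℚ) - a ∧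
        (t : ℚ) = ((q : ℚ) - a) * ((p : ℚ) - k) / ((p : ℚ) + q - a - k - 1) ∧
        (m : ℚ) = ((p : ℚ) ^ 2 - (k + 1) * p + k * q - k * a) / ((p : ℚ) + q - a - k - 1) ∧
        Nonempty (G ≃g
          (((⊤ : SimpleGraph (Fin t)) ⊕g completeSplit m n) ⊕g (⊥ : SimpleGraph (Fin a)))) := by
  obtain ⟨e⟩ := hG
  rw [Cospectral.congr_iso e]
  constructor
  · intro h
    obtain ⟨t, m, n, ht, hm, hn, ⟨e'⟩⟩ := exists_iso_of_cospectral hk hkp hq hG₁ hG₂ h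
    rw [Cospectral.congr_iso e', cospectral_completeSplit_iff hk hkp hq ht hm hn] at h
    obtain ⟨hna, htm, h1, h2⟩ := h
    zify at hk hkp hq ht hm hn
    have hm0 : (m : ℤ) ≠ 0 := by omega
    have h3 : (p - k - 1 : ℤ) * (n - t) = (t - 1) * n := by
      apply mul_left_cancel₀ hm0
      rw [h1] at h2
      linarith
    have hnt : (t : ℤ) < n := by
      have : 0 < (m : ℤ) * (n - t) := h1 ▸ mul_pos (by omega) (by omega)
      have := pos_of_mul_pos_right this (by omega)
      omega
    -- Once n = q - a is substituted, `h3` is linear in t; then m = p - t.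
    have hT : ((p : ℤ) + q - a - k - 1) * t = (q - a) * (p - k) := by
      rw [← sub_eq_zero] at hna
      linear_combination -h3 + (p - k - t) * hna
    have hM : ((p : ℤ) + q - a - k - 1) * m = p ^ 2 - (k + 1) * p + k * q - k * a := by
      linear_combination ((p : ℤ) + q - a - k - 1) * htm - hT
    have hD : (0 : ℤ) < p + q - a - k - 1 := by omega
    have hDQ : ((p : ℚ) + q - a - k - 1) ≠ 0 := by exact_mod_cast hD.ne'
    refine ⟨?_, by omega, ⟨t, by linarith⟩, t, m, n, by exact_mod_cast hna, ?_, ?_, ⟨e'.comp e⟩⟩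
    · rw [root_equation_eq, ← hM, ← hT, h1, ← hna]
      ring
    · rw [eq_div_iff hDQ]
      have := congrArg (Int.cast : ℤ → ℚ) hT
      push_cast at this
      linarith
    · rw [eq_div_iff hDQ]
      have := congrArg (Int.cast : ℤ → ℚ) hM
      push_cast at this
      linarith
  · rintro ⟨hc, ha, -, t, m, n, hn, ht, hm, ⟨e'⟩⟩
    have hDZ : (0 : ℤ) < p + q - a - k - 1 := by omega
    have hDQ : ((p : ℚ) + q - a - k - 1) ≠ 0 := by exact_mod_cast hDZ.ne'
    rw [eq_div_iff hDQ] at ht hm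
    have hn' : (n : ℤ) = q - a := by exact_mod_cast hn
    have hT : (t : ℤ) * (p + q - a - k - 1) = (q - a) * (p - k) := by exact_mod_cast ht
    have hM : (m : ℤ) * (p + q - a - k - 1) = p ^ 2 - (k + 1) * p + k * q - k * a := by
      exact_mod_cast hm
    have ht1 : (0 : ℤ) < t := by
      refine pos_of_mul_pos_left ?_ hDZ.le
      rw [hT]
      exact mul_pos (by omega) (by omega)
    have hm1 : (0 : ℤ) < m := by
      refine pos_of_mul_pos_left ?_ hDZ.le
      rw [hM]
      -- The numerator is p(p - k - 1) + k(q - a).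
      nlinarith
    have htm : (t : ℤ) + m = p := by
      apply mul_right_cancel₀ hDZ.ne'
      linear_combination hT + hM
    have h1 : (q : ℤ) * k = m * (n - t) := by
      apply mul_right_cancel₀ (pow_ne_zero 2 hDZ.ne')
      rw [root_equation_eq, ← hM, ← hT, ← hn'] at hc
      linear_combination hc
    have h3 : (p - k - 1 : ℤ) * (n - t) = (t - 1) * n := by
      rw [← sub_eq_zero] at hn'
      linear_combination -hT + (p - k - t) * hn'
    have h2 : (p - k - 1 : ℤ) * (q * k) = (t - 1) * (m * n) := by
      rw [h1]
      linear_combination (m : ℤ) * h3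
    -- The formula for t only gives t > 0; positivity of (p - k - 1)qk excludes t = 1.
    have ht2 : 2 ≤ t := by
      have h4 : (0 : ℤ) < (t - 1) * (m * n) :=
        h2 ▸ mul_pos (by omega) (mul_pos (by omega) (by omega))
      have := pos_of_mul_pos_left h4 (by positivity)
      omega
    rw [Cospectral.congr_iso (e'.comp e.symm),
      cospectral_completeSplit_iff hk hkp hq ht2 (by omega) (by omega)]
    exact ⟨hn', htm, h1, h2⟩
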